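/- Let $f_0:[0,1]\to\mathbb R$ satisfy $f_0(r)=\tilde f_0(r^2)$ with $\tilde f_0\in C^{2,\beta}([0,1])$ for some $\beta\in(0,1)$, and $\inf_{r\in(0,1]}f_0'(r)/r>0$. Put $$\kappa_1=\inf_{r\in[0,1]}\int_0^1 sf_0(rs)\,ds,\qquad \kappa_2=\sup_{r\in[0,1]}\int_0^1 sf_0(rs)\,ds,\qquad \mu^0_\Omega(r)=\frac{f_0'(r)}{r\big(\Omega-\int_0^1 sf_0(rs)\,ds\big)},$$ $$\widehat\Omega_n=\int_0^1 sf_0(s)\,ds-\frac{n+1}{n}\int_0^1 s^{2n+1}f_0(s)\,ds,\qquad H_n[h](r)=r^{2n}\int_r^1 s^{1-n}h(s)\,ds+\int_0^r s^{n+1}h(s)\,ds,$$ $$G_n(r)=n\Omega r^{n+1}+r^{n-1}\int_0^1 sf_0(s)\,ds-(n+1)r^{n-1}\int_0^r sf_0(s)\,ds+\frac{n+1}{r^{n+1}}\int_0^r s^{2n+1}f_0(s)\,ds,$$ so that $G_n(1)=n(\Omega-\widehat\Omega_n)$. For every integer $n\ge1$ and every real $\Omega\notin[\kappa_1,\kappa_2]$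 there is a unique function $F_{n,\Omega}$ of class $C^2$ on $[0,1]$ such that $$F_{n,\Omega}''+\frac{2n+1}{r}F_{n,\Omega}'+\mu^0_\Omega F_{n,\Omega}=0\ \text{ on }(0,1],\qquad F_{n,\Omega}(0)=1;$$ set $$\zeta_n(\Omega)=F_{n,\Omega}(1)\Big(\Omega-\frac{n}{n+1}\int_0^1 sf_0(s)\,ds\Big)+\int_0^1F_{n,\Omega}(s)\,s^{2n+1}\big(f_0(s)-2\Omega\big)\,ds.$$ There is a constant $C_0>0$ depending only on $f_0$ such that the following holds for every integer $n\ge1$ and every real $\Omega\notin[\kappa_1,\kappa_2]$ with $\Omega\ne\widehat\Omega_n$. If $\Omega>\kappa_2$, assume moreover that $$\frac{C_0}{n\,\theta\,(\Omega-\kappa_2)^\theta}<1\quad\text{for some }\theta\in(0,1].$$ Then the equation $$h(r)-\frac{\mu^0_\Omega(r)}{2nr^n}H_n[h](r)=-\frac{H_n[h](1)}{2nG_n(1)}\,\mu^0_\Omega(r)\,r\,G_n(r),\qquad r\in(0,1],$$ has a solution $h$ that is continuous on $[0,1]$ and not identically zero if and only if $\zeta_n(\Omega)=0$. -/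

import Mathlib

open Set MeasureTheory
open scoped NNReal

noncomputable section

/-- The admissible profiles `f₀ : [0,1] → ℝ` (values outside `[0,1]` are irrelevant):
`f₀ r = g (r²)` with `g` of class `C^{2,β}` on `[0,1]` for some `β ∈ (0,1)`, and
`inf_{0 < r ≤ 1} f₀'(r) / r > 0`. Derivatives on `[0,1]` are one-sided at the end points. -/
structure IsProfile (f₀ : ℝ → ℝ) : Prop where
  regular : ∃ (g : ℝ → ℝ) (β C : ℝ≥0), 0 < β ∧ β < 1 ∧
    ContDiffOn ℝ 2 g (Icc 0 1) ∧
    HolderOnWith C β (iteratedDerivWithin 2 g (Icc 0 1)) (Icc 0 1) ∧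
    ∀ r ∈ Icc (0 : ℝ) 1, f₀ r = g (r ^ 2)
  monotone : ∃ c : ℝ, 0 < c ∧ ∀ r ∈ Ioc (0 : ℝ) 1, c ≤ derivWithin f₀ (Icc 0 1) r / r

/-- The average `∫₀¹ s f₀(r s) ds`. -/
def profileMean (f₀ : ℝ → ℝ) (r : ℝ) : ℝ := ∫ s in (0 : ℝ)..1, s * f₀ (r * s)

/-- `κ₁ = inf_{r ∈ [0,1]} ∫₀¹ s f₀(r s) ds`. -/
def kappa₁ (f₀ : ℝ → ℝ) : ℝ := sInf (profileMean f₀ '' Icc 0 1)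

/-- `κ₂ = sup_{r ∈ [0,1]} ∫₀¹ s f₀(r s) ds`. -/
def kappa₂ (f₀ : ℝ → ℝ) : ℝ := sSup (profileMean f₀ '' Icc 0 1)

/-- The potential `μ_Ω⁰(r) = f₀'(r) / (r (Ω - ∫₀¹ s f₀(r s) ds))`, for `r ∈ (0,1]`. -/
def mu (f₀ : ℝ → ℝ) (Ω r : ℝ) : ℝ :=
  derivWithin f₀ (Icc 0 1) r / (r * (Ω - profileMean f₀ r))

/-- The singular value `Ω̂_n`. -/
def omegaHat (f₀ : ℝ → ℝ) (n : ℕ) : ℝ :=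
  (∫ s in (0 : ℝ)..1, s * f₀ s)
    - ((n : ℝ) + 1) / n * ∫ s in (0 : ℝ)..1, s ^ (2 * n + 1) * f₀ s

/-- `H_n[h](r) = r^{2n} ∫_r^1 s^{1-n} h(s) ds + ∫_0^r s^{n+1} h(s) ds`. -/
def Hop (n : ℕ) (h : ℝ → ℝ) (r : ℝ) : ℝ :=
  r ^ (2 * n) * (∫ s in r..1, s ^ (1 - (n : ℤ)) * h s)
    + ∫ s in (0 : ℝ)..r, s ^ (n + 1) * h s

/-- The function `G_n`, for `n ≥ 1` and `r ∈ (0,1]`. -/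
def Gfun (f₀ : ℝ → ℝ) (Ω : ℝ) (n : ℕ) (r : ℝ) : ℝ :=
  n * Ω * r ^ (n + 1)
    + r ^ (n - 1) * (∫ s in (0 : ℝ)..1, s * f₀ s)
    - ((n : ℝ) + 1) * r ^ (n - 1) * (∫ s in (0 : ℝ)..r, s * f₀ s)
    + ((n : ℝ) + 1) / r ^ (n + 1) * ∫ s in (0 : ℝ)..r, s ^ (2 * n + 1) * f₀ s

/-- `h` solves the kernel equation of mode `n` (with `n ≥ 1` and `G_n(1) ≠ 0`) on `(0,1]`. -/
def SolvesKernelEq (f₀ : ℝ → ℝ) (Ω : ℝ) (n : ℕ) (h : ℝ → ℝ) : Prop :=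
  ∀ r ∈ Ioc (0 : ℝ) 1,
    h r - mu f₀ Ω r / (2 * n * r ^ n) * Hop n h r
      = -(Hop n h 1 / (2 * n * Gfun f₀ Ω n 1)) * mu f₀ Ω r * r * Gfun f₀ Ω n r

/-- `F` is of class `C²` on `[0,1]`, `F(0) = 1` and `F'' + (2n+1)/r F' + μ_Ω⁰ F = 0`. -/
structure IsRegularSolution (f₀ : ℝ → ℝ) (n : ℕ) (Ω : ℝ) (F : ℝ → ℝ) : Prop where
  contDiffOn : ContDiffOn ℝ 2 F (Icc 0 1)
  init : F 0 = 1
  ode : ∀ r ∈ Ioc (0 : ℝ) 1,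
    derivWithin (derivWithin F (Icc 0 1)) (Icc 0 1) r
      + (2 * n + 1) / r * derivWithin F (Icc 0 1) r + mu f₀ Ω r * F r = 0

/-- The solution `F_{n,Ω}`. That it exists and is unique on `[0,1]` is part of the theorem. -/
def generator (f₀ : ℝ → ℝ) (n : ℕ) (Ω : ℝ) : ℝ → ℝ :=
  Classical.epsilon (IsRegularSolution f₀ n Ω)

/-- The dispersion function `ζ_n(Ω)`. -/
def zeta (f₀ : ℝ → ℝ) (n : ℕ) (Ω : ℝ) : ℝ :=
  generator f₀ n Ω 1 * (Ω - (n : ℝ) / (n + 1) * ∫ s in (0 : ℝ)..1, s * f₀ s)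
    + ∫ s in (0 : ℝ)..1, generator f₀ n Ω s * s ^ (2 * n + 1) * (f₀ s - 2 * Ω)

end

/-!
Write `α = Ω - n/(n+1) ∫₀¹ s f₀`, and let `F` be the regular solution of
`F'' + (2n+1)/r F' + μ F = 0`. The kernel equation says that `h = -μ r^n w`, where for some
constant `C` the function `w` solves `(r^(2n+1) w')' = r^(2n+1) (C (f₀ - 2Ω) - μ w)` with the two
Cauchy data `w(1) = 0`, `w'(1) = -C α`. Green's identity against `F` turns these into
`C (∫₀¹ s^(2n+1) (f₀ - 2Ω) F + α F(1)) = C ζ_n(Ω) = 0`, because the singular part of `w` at the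
origin is too weak to contribute. If `ζ_n(Ω) ≠ 0`, then `C = 0`, and the Cauchy data force `w = 0`.
If `ζ_n(Ω) = 0`, the Fredholm alternative provides such a `w` with `C = 1`, and `h ≠ 0` since
`h = 0` would force `G_n(1) = 0`.
-/

open Filter Topology

noncomputable section

/-- The weighted mean `∫₀¹ s^N ψ(r s) ds` along rays; `profileMean` is the case `N = 1`. -/
def radialMean (N : ℕ) (ψ : ℝ → ℝ) (r : ℝ) : ℝ := ∫ s in (0 : ℝ)..1, s ^ N * ψ (r * s)

/-- The solution `y` of `(r^N y')' = r^N ψ` with `y(0) = y'(0) = 0`; the factor `r^(-N)` is absorbed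
into `radialMean`, so that nothing is singular at `r = 0`. -/
def radialInt (N : ℕ) (ψ : ℝ → ℝ) (r : ℝ) : ℝ := ∫ t in (0 : ℝ)..r, t * radialMean N ψ t

theorem exists_continuous_eqOn_Icc {α β : Type*} [LinearOrder α] [TopologicalSpace α]
    [OrderTopology α] [TopologicalSpace β] {a b : α} (hab : a ≤ b) {f : α → β}
    (hf : ContinuousOn f (Icc a b)) : ∃ g : α → β, Continuous g ∧ EqOn g f (Icc a b) :=
  ⟨IccExtend hab (domRestrict (Icc a b) f), hf.domRestrict.Icc_extend',
    fun x hx => by rw [IccExtend_of_mem _ _ hx, domRestrict_apply]⟩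

theorem intervalIntegral_mul_congr {f g w : ℝ → ℝ} (hfg : EqOn f g (Icc 0 1)) {a b : ℝ}
    (ha : a ∈ Icc (0 : ℝ) 1) (hb : b ∈ Icc (0 : ℝ) 1) :
    ∫ s in a..b, w s * f s = ∫ s in a..b, w s * g s :=
  intervalIntegral.integral_congr fun s hs => by
    simp only [hfg (uIcc_subset_Icc ha hb hs)]

section RadialIntegral

variable {N : ℕ} {ψ χ : ℝ → ℝ} {r : ℝ}

theorem hasDerivAt_integral_pow_mul (N : ℕ) (hψ : Continuous ψ) (r : ℝ) :
    HasDerivAt (fun r => ∫ t in (0 : ℝ)..r, t ^ N * ψ t) (r ^ N * ψ r) r :=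
  ((by fun_prop : Continuous fun t => t ^ N * ψ t).integral_hasStrictDerivAt 0 r).hasDerivAt

theorem continuous_integral_pow_mul (N : ℕ) (hψ : Continuous ψ) :
    Continuous fun r => ∫ t in (0 : ℝ)..r, t ^ N * ψ t :=
  continuous_iff_continuousAt.2 fun r => (hasDerivAt_integral_pow_mul N hψ r).continuousAt

theorem radialMean_congr (h : EqOn ψ χ (Icc 0 1)) (hr : r ∈ Icc (0 : ℝ) 1) :
    radialMean N ψ r = radialMean N χ r := by
  refine intervalIntegral.integral_congr fun s hs => ?_
  rw [uIcc_of_le zero_le_one] at hs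
  simp only [h ⟨mul_nonneg hr.1 hs.1, mul_le_one₀ hr.2 hs.1 hs.2⟩]

theorem radialInt_congr (h : EqOn ψ χ (Icc 0 1)) (hr : r ∈ Icc (0 : ℝ) 1) :
    radialInt N ψ r = radialInt N χ r :=
  intervalIntegral_mul_congr (fun _ ht => radialMean_congr h ht) (left_mem_Icc.2 zero_le_one) hr

theorem continuous_radialMean (N : ℕ) (hψ : Continuous ψ) : Continuous (radialMean N ψ) :=
  intervalIntegral.continuous_parametric_intervalIntegral_of_continuous' (by fun_prop) 0 1

theorem hasDerivAt_radialInt (N : ℕ) (hψ : Continuous ψ) (r : ℝ) :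
    HasDerivAt (radialInt N ψ) (r * radialMean N ψ r) r :=
  ((continuous_id.mul (continuous_radialMean N hψ)).integral_hasStrictDerivAt 0 r).hasDerivAt

theorem continuous_radialInt (N : ℕ) (hψ : Continuous ψ) : Continuous (radialInt N ψ) :=
  continuous_iff_continuousAt.2 fun r => (hasDerivAt_radialInt N hψ r).continuousAt

theorem radialInt_zero (N : ℕ) (ψ : ℝ → ℝ) : radialInt N ψ 0 = 0 :=
  intervalIntegral.integral_same

theorem radialMean_zero (N : ℕ) (ψ : ℝ → ℝ) : radialMean N ψ 0 = ψ 0 / (N + 1) := by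
  simp [radialMean, div_eq_inv_mul]

theorem pow_mul_radialMean (N : ℕ) (ψ : ℝ → ℝ) (r : ℝ) :
    r ^ (N + 1) * radialMean N ψ r = ∫ t in (0 : ℝ)..r, t ^ N * ψ t := by
  have hsubst := intervalIntegral.mul_integral_comp_mul_left (a := 0) (b := 1)
    (f := fun t => t ^ N * ψ t) (c := r)
  rw [mul_zero, mul_one] at hsubst
  rw [← hsubst, radialMean, pow_succ', mul_assoc, ← intervalIntegral.integral_const_mul]
  congr 2
  ext s
  ring

theorem mul_radialMean (hr : r ≠ 0) :
    r * radialMean N ψ r = (∫ t in (0 : ℝ)..r, t ^ N * ψ t) / r ^ N := by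
  rw [← pow_mul_radialMean, pow_succ]
  field_simp

theorem hasDerivAt_mul_radialMean (N : ℕ) (hψ : Continuous ψ) (r : ℝ) :
    HasDerivAt (fun r => r * radialMean N ψ r) (ψ r - N * radialMean N ψ r) r := by
  rcases eq_or_ne r 0 with rfl | hr
  · have hslope : ψ 0 - N * radialMean N ψ 0 = radialMean N ψ 0 := by
      rw [radialMean_zero]
      field_simp
      ring
    rw [hslope, hasDerivAt_iff_tendsto_slope]
    refine ((continuous_radialMean N hψ).tendsto 0).mono_left nhdsWithin_le_nhds |>.congr' ?_
    filter_upwards [self_mem_nhdsWithin] with t (ht : t ≠ 0)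
    simp [slope_def_field, ht]
  · have hquot : (fun r => r * radialMean N ψ r) =ᶠ[𝓝 r]
        fun r => (∫ t in (0 : ℝ)..r, t ^ N * ψ t) / r ^ N := by
      filter_upwards [isOpen_ne.mem_nhds hr] with t ht using mul_radialMean ht
    refine (((hasDerivAt_integral_pow_mul N hψ r).div (hasDerivAt_pow N r)
      (pow_ne_zero N hr)).congr_of_eventuallyEq hquot).congr_deriv ?_
    rw [← pow_mul_radialMean]
    rcases N with _ | N
    · simp
    · simp only [Nat.add_sub_cancel]
      field_simp
      ring

theorem contDiff_two_radialInt (N : ℕ) (hψ : Continuous ψ) : ContDiff ℝ 2 (radialInt N ψ) := by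
  have hderiv : deriv (radialInt N ψ) = fun r => r * radialMean N ψ r :=
    funext fun r => (hasDerivAt_radialInt N hψ r).deriv
  have hderiv₂ : deriv (fun r => r * radialMean N ψ r) = fun r => ψ r - N * radialMean N ψ r :=
    funext fun r => (hasDerivAt_mul_radialMean N hψ r).deriv
  rw [← one_add_one_eq_two, contDiff_succ_iff_deriv, hderiv, contDiff_one_iff_deriv, hderiv₂]
  exact ⟨fun r => (hasDerivAt_radialInt N hψ r).differentiableAt, by simp,
    fun r => (hasDerivAt_mul_radialMean N hψ r).differentiableAt,
    hψ.sub (continuous_const.mul (continuous_radialMean N hψ))⟩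

theorem radialMean_add_const_mul (N : ℕ) (hψ : Continuous ψ) (hχ : Continuous χ) (b r : ℝ) :
    radialMean N (fun t => ψ t + b * χ t) r = radialMean N ψ r + b * radialMean N χ r := by
  simp only [radialMean, ← intervalIntegral.integral_const_mul, mul_add, mul_left_comm _ b]
  exact intervalIntegral.integral_add (Continuous.intervalIntegrable (by fun_prop) _ _)
    (Continuous.intervalIntegrable (by fun_prop) _ _)

theorem radialInt_add_const_mul (N : ℕ) (hψ : Continuous ψ) (hχ : Continuous χ) (b r : ℝ) :
    radialInt N (fun t => ψ t + b * χ t) r = radialInt N ψ r + b * radialInt N χ r := by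
  have hψm := continuous_radialMean N hψ
  have hχm := continuous_radialMean N hχ
  simp only [radialInt, radialMean_add_const_mul N hψ hχ,
    ← intervalIntegral.integral_const_mul, mul_add, mul_left_comm _ b]
  exact intervalIntegral.integral_add (Continuous.intervalIntegrable (by fun_prop) _ _)
    (Continuous.intervalIntegrable (by fun_prop) _ _)

theorem abs_radialMean_le {C : ℝ} {k : ℕ} (h : ∀ t ∈ Icc (0 : ℝ) 1, |ψ t| ≤ C * t ^ k)
    (hr : r ∈ Icc (0 : ℝ) 1) : |radialMean N ψ r| ≤ C * r ^ k := by
  have hC : 0 ≤ C := by simpa using (abs_nonneg _).trans (h 1 (right_mem_Icc.2 zero_le_one))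
  have hr₀ := hr.1
  rw [radialMean, ← Real.norm_eq_abs]
  refine (intervalIntegral.norm_integral_le_of_norm_le_const (C := C * r ^ k)
    fun s hs => ?_).trans_eq (by simp)
  rw [uIoc_of_le zero_le_one] at hs
  have hs₀ := hs.1.le
  rw [Real.norm_eq_abs, abs_mul, abs_of_nonneg (pow_nonneg hs₀ N)]
  calc s ^ N * |ψ (r * s)| ≤ 1 * |ψ (r * s)| := by
        gcongr
        exact pow_le_one₀ hs₀ hs.2
    _ ≤ C * (r * s) ^ k := by
        rw [one_mul]
        exact h _ ⟨by positivity, mul_le_one₀ hr.2 hs₀ hs.2⟩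
    _ ≤ C * r ^ k := by
        gcongr
        exact mul_le_of_le_one_right hr₀ hs.2

theorem abs_radialInt_le {C : ℝ} {k : ℕ} (h : ∀ t ∈ Icc (0 : ℝ) 1, |ψ t| ≤ C * t ^ k)
    (hr : r ∈ Icc (0 : ℝ) 1) : |radialInt N ψ r| ≤ C * (r ^ (k + 1) / (k + 1)) := by
  have hmajorant : ∫ t in (0 : ℝ)..r, C * t ^ k = C * (r ^ (k + 1) / (k + 1)) := by simp
  rw [← hmajorant, radialInt, ← Real.norm_eq_abs]
  refine intervalIntegral.norm_integral_le_of_norm_le hr.1 (Eventually.of_forall fun t ht => ?_)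
    (Continuous.intervalIntegrable (by fun_prop) _ _)
  have ht₁ := ht.2.trans hr.2
  have hmean := abs_radialMean_le (N := N) h ⟨ht.1.le, ht₁⟩
  rw [Real.norm_eq_abs, abs_mul, abs_of_pos ht.1]
  exact (mul_le_of_le_one_left (abs_nonneg _) ht₁).trans hmean

end RadialIntegral

section Picard

theorem continuous_radialPicard_source (φ μ : C(ℝ, ℝ)) (u : C(Icc (0 : ℝ) 1, ℝ)) :
    Continuous fun t => φ t - μ t * IccExtend zero_le_one u t :=
  φ.continuous.sub (μ.continuous.mul u.continuous.Icc_extend')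

/-- The Picard map `y ↦ a + radialInt N (φ - μ y)` on `C([0,1])`, whose fixed points solve
`(r^N y')' = r^N (φ - μ y)`, `y(0) = a`. -/
def radialPicard (N : ℕ) (a : ℝ) (φ μ : C(ℝ, ℝ)) (u : C(Icc (0 : ℝ) 1, ℝ)) :
    C(Icc (0 : ℝ) 1, ℝ) where
  toFun r := a + radialInt N (fun t => φ t - μ t * IccExtend zero_le_one u t) r
  continuous_toFun := continuous_const.add
    ((continuous_radialInt N (continuous_radialPicard_source φ μ u)).comp continuous_subtype_val)

variable (N : ℕ) (a : ℝ) (φ μ : C(ℝ, ℝ))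

theorem abs_radialPicard_sub_le {L C : ℝ} (hL : ∀ t ∈ Icc (0 : ℝ) 1, |μ t| ≤ L) {k : ℕ}
    {u v : C(Icc (0 : ℝ) 1, ℝ)} (h : ∀ t, |u t - v t| ≤ (L * t) ^ k / k.factorial * C)
    (r : Icc (0 : ℝ) 1) :
    |radialPicard N a φ μ u r - radialPicard N a φ μ v r|
      ≤ (L * r) ^ (k + 1) / (k + 1).factorial * C := by
  let U : ℝ → ℝ := fun t => φ t - μ t * IccExtend zero_le_one u t
  let V : ℝ → ℝ := fun t => φ t - μ t * IccExtend zero_le_one v t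
  have hsource : ∀ t ∈ Icc (0 : ℝ) 1,
      |U t + -1 * V t| ≤ L ^ (k + 1) / k.factorial * C * t ^ k := fun t ht => by
    have hUV : U t + -1 * V t = -(μ t * (u ⟨t, ht⟩ - v ⟨t, ht⟩)) := by
      simp only [U, V, IccExtend_of_mem _ _ ht]
      ring
    rw [hUV, abs_neg, abs_mul]
    calc |μ t| * |u ⟨t, ht⟩ - v ⟨t, ht⟩| ≤ L * ((L * t) ^ k / k.factorial * C) :=
          mul_le_mul (hL t ht) (h ⟨t, ht⟩) (abs_nonneg _) ((abs_nonneg _).trans (hL t ht))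
      _ = L ^ (k + 1) / k.factorial * C * t ^ k := by rw [mul_pow]; ring
  calc |radialPicard N a φ μ u r - radialPicard N a φ μ v r|
      = |radialInt N (fun t => U t + -1 * V t) r| := by
        rw [radialInt_add_const_mul N (continuous_radialPicard_source φ μ u)
          (continuous_radialPicard_source φ μ v), neg_one_mul, ← sub_eq_add_neg]
        exact congrArg _ (add_sub_add_left_eq_sub _ _ a)
    _ ≤ L ^ (k + 1) / k.factorial * C * (r ^ (k + 1) / (k + 1)) := abs_radialInt_le hsource r.2
    _ = (L * r) ^ (k + 1) / (k + 1).factorial * C := by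
        rw [Nat.factorial_succ, mul_pow]
        push_cast
        field_simp

theorem exists_contractingWith_iterate_radialPicard :
    ∃ (k : ℕ) (K : ℝ≥0), ContractingWith K (radialPicard N a φ μ)^[k] := by
  obtain ⟨L, hL⟩ := isCompact_Icc.exists_bound_of_continuousOn
    (map_continuous μ).continuousOn (s := Icc (0 : ℝ) 1)
  have hL₀ : 0 ≤ L := (norm_nonneg _).trans (hL 0 (left_mem_Icc.2 zero_le_one))
  have hiterate : ∀ (k : ℕ) (u v : C(Icc (0 : ℝ) 1, ℝ)) (t : Icc (0 : ℝ) 1),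
      |(radialPicard N a φ μ)^[k] u t - (radialPicard N a φ μ)^[k] v t|
        ≤ (L * t) ^ k / k.factorial * dist u v := fun k u v => by
    induction k with
    | zero => simpa [Real.dist_eq] using ContinuousMap.dist_apply_le_dist (f := u) (g := v)
    | succ k ih =>
      simp only [Function.iterate_succ_apply']
      exact abs_radialPicard_sub_le N a φ μ hL ih
  obtain ⟨k, hk⟩ := ((FloorSemiring.tendsto_pow_div_factorial_atTop L).eventually
    (gt_mem_nhds one_pos)).exists
  refine ⟨k, (L ^ k / k.factorial).toNNReal, by simpa using hk,
    LipschitzWith.of_dist_le_mul fun u v => ?_⟩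
  rw [Real.coe_toNNReal _ (by positivity), ContinuousMap.dist_le (by positivity)]
  intro t
  refine (hiterate k u v t).trans ?_
  have ht₀ := t.2.1
  gcongr
  exact mul_le_of_le_one_right hL₀ t.2.2

theorem existsUnique_isFixedPt_radialPicard :
    ∃! u, Function.IsFixedPt (radialPicard N a φ μ) u := by
  obtain ⟨k, K, hK⟩ := exists_contractingWith_iterate_radialPicard N a φ μ
  exact ⟨_, hK.isFixedPt_fixedPoint_iterate,
    fun v hv => hK.fixedPoint_unique (Function.IsFixedPt.iterate hv k)⟩

end Picard

section RadialSolution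

/-- `y` solves `(r^N y')' = r^N (φ - μ y)` on `[0,1]` regularly at the origin, in integrated form.
The source `ψ` agrees with `φ - μ y` on `[0,1]` only; outside, it just continues `y` past `r = 1`,
so that derivatives at `r = 1` are two-sided. -/
structure IsRadialSolution (N : ℕ) (μ φ ψ y : ℝ → ℝ) : Prop where
  continuous_source : Continuous ψ
  source_eq : ∀ t ∈ Icc (0 : ℝ) 1, ψ t = φ t - μ t * y t
  eq_add_radialInt : ∀ t, y t = y 0 + radialInt N ψ t

variable {N : ℕ} {μ φ ψ χ y F : ℝ → ℝ}

theorem exists_isRadialSolution (N : ℕ) (hφ : Continuous φ) (hμ : Continuous μ) (a : ℝ) :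
    ∃ ψ y, IsRadialSolution N μ φ ψ y ∧ y 0 = a := by
  let φ' : C(ℝ, ℝ) := ⟨φ, hφ⟩
  let μ' : C(ℝ, ℝ) := ⟨μ, hμ⟩
  obtain ⟨u, hu, -⟩ := existsUnique_isFixedPt_radialPicard N a φ' μ'
  let ψ : ℝ → ℝ := fun t => φ t - μ t * IccExtend zero_le_one u t
  have hzero : a + radialInt N ψ 0 = a := by rw [radialInt_zero, add_zero]
  refine ⟨ψ, fun t => a + radialInt N ψ t, ⟨continuous_radialPicard_source φ' μ' u,
    fun t ht => ?_, fun t => ?_⟩, hzero⟩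
  · simp only [ψ, IccExtend_of_mem _ _ ht]
    exact congrArg (φ t - μ t * ·) (DFunLike.congr_fun hu ⟨t, ht⟩).symm
  · simp only [hzero]

theorem eqOn_of_eq_add_radialInt {y₁ y₂ : ℝ → ℝ} {a : ℝ} (hφ : Continuous φ) (hμ : Continuous μ)
    (hy₁ : ContinuousOn y₁ (Icc 0 1)) (hy₂ : ContinuousOn y₂ (Icc 0 1))
    (h₁ : ∀ r ∈ Icc (0 : ℝ) 1, y₁ r = a + radialInt N (fun t => φ t - μ t * y₁ t) r)
    (h₂ : ∀ r ∈ Icc (0 : ℝ) 1, y₂ r = a + radialInt N (fun t => φ t - μ t * y₂ t) r) :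
    EqOn y₁ y₂ (Icc 0 1) := by
  let φ' : C(ℝ, ℝ) := ⟨φ, hφ⟩
  let μ' : C(ℝ, ℝ) := ⟨μ, hμ⟩
  have hfixed : ∀ y (hy : ContinuousOn y (Icc 0 1)),
      (∀ r ∈ Icc (0 : ℝ) 1, y r = a + radialInt N (fun t => φ t - μ t * y t) r) →
      Function.IsFixedPt (radialPicard N a φ' μ') ⟨_, hy.domRestrict⟩ := fun y hy h => by
    ext r
    refine Eq.trans (congrArg (a + ·) (radialInt_congr (fun t ht => ?_) r.2)) (h r r.2).symm
    rw [IccExtend_of_mem _ _ ht]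
    rfl
  have hunique := (existsUnique_isFixedPt_radialPicard N a φ' μ').unique
    (hfixed y₁ hy₁ h₁) (hfixed y₂ hy₂ h₂)
  exact fun r hr => DFunLike.congr_fun hunique ⟨r, hr⟩

theorem IsRadialSolution.hasDerivAt (hy : IsRadialSolution N μ φ ψ y) (r : ℝ) :
    HasDerivAt y (r * radialMean N ψ r) r := by
  rw [funext hy.eq_add_radialInt]
  exact (hasDerivAt_radialInt N hy.continuous_source r).const_add _

theorem IsRadialSolution.continuous (hy : IsRadialSolution N μ φ ψ y) : Continuous y :=
  continuous_iff_continuousAt.2 fun r => (hy.hasDerivAt r).continuousAt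

theorem IsRadialSolution.add_const_mul (hy : IsRadialSolution N μ φ ψ y)
    (hF : IsRadialSolution N μ 0 χ F) (b : ℝ) :
    IsRadialSolution N μ φ (fun t => ψ t + b * χ t) (fun t => y t + b * F t) where
  continuous_source := hy.continuous_source.add (continuous_const.mul hF.continuous_source)
  source_eq t ht := by
    rw [hy.source_eq t ht, hF.source_eq t ht, Pi.zero_apply]
    ring
  eq_add_radialInt t := by
    rw [radialInt_add_const_mul N hy.continuous_source hF.continuous_source,
      hy.eq_add_radialInt t, hF.eq_add_radialInt t]
    ring

end RadialSolution

theorem eqOn_zero_of_hasDerivAt_clm {E : Type*} [NormedAddCommGroup E] [NormedSpace ℝ E]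
    {A : ℝ → E →L[ℝ] E} {z : ℝ → E} {a b : ℝ} (hA : ContinuousOn A (Icc a b))
    (hz : ∀ t ∈ Icc a b, HasDerivAt z (A t (z t)) t) (hzb : z b = 0) : EqOn z 0 (Icc a b) := by
  obtain ⟨K, hK⟩ := isCompact_Icc.exists_bound_of_continuousOn hA
  have hlip : ∀ t ∈ Ioc a b, LipschitzOnWith K.toNNReal (A t) univ := fun t ht =>
    ((A t).lipschitz.weaken ((norm_toNNReal (a := A t)).symm.le.trans
      (Real.toNNReal_le_toNNReal (hK t (Ioc_subset_Icc_self ht))))).lipschitzOnWith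
  exact ODE_solution_unique_of_mem_Icc_left hlip
    (fun t ht => (hz t ht).continuousAt.continuousWithinAt)
    (fun t ht => (hz t (Ioc_subset_Icc_self ht)).hasDerivWithinAt) (fun _ _ => mem_univ _)
    continuousOn_const
    (fun t _ => (hasDerivWithinAt_const t (Iic t) (0 : E)).congr_deriv (map_zero (A t)).symm)
    (fun _ _ => mem_univ _) hzb

section RadialPair

/-- `(y, P)` solves the first order system `r^N y' = P`, `P' = r^N (φ - μ y)` on `(0,1]`, with no
condition at the origin. -/
structure IsRadialPair (N : ℕ) (μ φ y P : ℝ → ℝ) : Prop where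
  hasDerivAt_fst : ∀ r ∈ Ioc (0 : ℝ) 1, HasDerivAt y (P r / r ^ N) r
  hasDerivAt_snd : ∀ r ∈ Ioc (0 : ℝ) 1, HasDerivAt P (r ^ N * (φ r - μ r * y r)) r

variable {N : ℕ} {μ φ ψ χ y P F Q : ℝ → ℝ}

theorem IsRadialSolution.isRadialPair (hy : IsRadialSolution N μ φ ψ y) :
    IsRadialPair N μ φ y fun r => ∫ t in (0 : ℝ)..r, t ^ N * ψ t where
  hasDerivAt_fst r hr := (hy.hasDerivAt r).congr_deriv (mul_radialMean hr.1.ne')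
  hasDerivAt_snd r hr := by
    rw [← hy.source_eq r (Ioc_subset_Icc_self hr)]
    exact hasDerivAt_integral_pow_mul N hy.continuous_source r

theorem IsRadialPair.integral_eq_wronskian (hy : IsRadialPair N μ φ y P)
    (hF : IsRadialPair N μ 0 F Q) (hφ : Continuous φ) (hFc : Continuous F)
    (h₀ : Tendsto (fun r => P r * F r - y r * Q r) (𝓝[>] 0) (𝓝 0)) :
    ∫ s in (0 : ℝ)..1, s ^ N * φ s * F s = P 1 * F 1 - y 1 * Q 1 := by
  have hderiv : ∀ r ∈ Ioc (0 : ℝ) 1,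
      HasDerivAt (fun r => P r * F r - y r * Q r) (r ^ N * φ r * F r) r := fun r hr => by
    refine (((hy.hasDerivAt_snd r hr).mul (hF.hasDerivAt_fst r hr)).sub
      ((hy.hasDerivAt_fst r hr).mul (hF.hasDerivAt_snd r hr))).congr_deriv ?_
    have hr₀ : r ≠ 0 := hr.1.ne'
    rw [Pi.zero_apply]
    field_simp
    ring
  rw [intervalIntegral.integral_eq_sub_of_hasDerivAt_of_tendsto zero_lt_one
    (fun r hr => hderiv r (Ioo_subset_Ioc_self hr))
    (Continuous.intervalIntegrable (by fun_prop) _ _) h₀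
    ((hderiv 1 ⟨zero_lt_one, le_rfl⟩).continuousAt.tendsto.mono_left nhdsWithin_le_nhds), sub_zero]

theorem IsRadialPair.eqOn_zero (hy : IsRadialPair N μ 0 y P) (hμ : Continuous μ) (hy₁ : y 1 = 0)
    (hP₁ : P 1 = 0) : EqOn y 0 (Ioc 0 1) := by
  intro r hr
  let A : ℝ → ℝ × ℝ →L[ℝ] ℝ × ℝ := fun t =>
    (t ^ N)⁻¹ • .inl ℝ ℝ ℝ ∘L .snd ℝ ℝ ℝ - (t ^ N * μ t) • .inr ℝ ℝ ℝ ∘L .fst ℝ ℝ ℝ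
  have hA : ContinuousOn A (Icc r 1) := by
    refine ContinuousOn.sub (ContinuousOn.smul ((continuousOn_pow N).inv₀ fun t ht => ?_)
      continuousOn_const) (Continuous.continuousOn (by fun_prop))
    exact pow_ne_zero N (hr.1.trans_le ht.1).ne'
  have hz : ∀ t ∈ Icc r 1, HasDerivAt (fun t => (y t, P t)) (A t (y t, P t)) t := fun t ht => by
    have ht' : t ∈ Ioc (0 : ℝ) 1 := ⟨hr.1.trans_le ht.1, ht.2⟩
    convert (hy.hasDerivAt_fst t ht').prodMk (hy.hasDerivAt_snd t ht') using 1
    simp [A, div_eq_inv_mul, mul_assoc]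
  exact congrArg Prod.fst (eqOn_zero_of_hasDerivAt_clm hA hz (by simp [hy₁, hP₁]) ⟨le_rfl, hr.2⟩)

theorem IsRadialSolution.integral_ne_zero_of_apply_one_eq_zero (hF : IsRadialSolution N μ 0 χ F)
    (hμ : Continuous μ) (hF₀ : F 0 ≠ 0) (hF₁ : F 1 = 0) :
    ∫ t in (0 : ℝ)..1, t ^ N * χ t ≠ 0 := fun hQ₁ => by
  have hzero := (hF.isRadialPair.eqOn_zero hμ hF₁ hQ₁).closure hF.continuous continuous_const
  rw [closure_Ioc zero_ne_one] at hzero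
  exact hF₀ (hzero (left_mem_Icc.2 zero_le_one))

theorem exists_add_mul_eq {K : Type*} [Field K] {x z u v p : K} (h : p * u = z * u - x * v)
    (huv : u = 0 → v ≠ 0) : ∃ b, x + b * u = 0 ∧ z + b * v = p := by
  by_cases hu : u = 0
  · have hx : x = 0 := by simpa [hu, huv hu] using h
    exact ⟨(p - z) / v, by simp [hu, hx], by rw [div_mul_cancel₀ _ (huv hu), add_sub_cancel]⟩
  · refine ⟨-x / u, by rw [div_mul_cancel₀ _ hu, add_neg_cancel], mul_right_cancel₀ hu ?_⟩
    field_simp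
    linear_combination -h

/-- The Fredholm alternative: prescribing both Cauchy data at `r = 1` overdetermines a regular
solution, and pairing with the homogeneous solution `F` is the only obstruction. -/
theorem IsRadialSolution.exists_of_integral_eq (hF : IsRadialSolution N μ 0 χ F)
    (hφ : Continuous φ) (hμ : Continuous μ) (hF₀ : F 0 ≠ 0) {p : ℝ}
    (hp : ∫ s in (0 : ℝ)..1, s ^ N * φ s * F s = p * F 1) :
    ∃ ψ y, IsRadialSolution N μ φ ψ y ∧ y 1 = 0 ∧ ∫ t in (0 : ℝ)..1, t ^ N * ψ t = p := by
  obtain ⟨ψ, y, hy, -⟩ := exists_isRadialSolution N hφ hμ 0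
  have hPc := continuous_integral_pow_mul N hy.continuous_source
  have hQc := continuous_integral_pow_mul N hF.continuous_source
  have hwronskian : Continuous fun r => (∫ t in (0 : ℝ)..r, t ^ N * ψ t) * F r
      - y r * ∫ t in (0 : ℝ)..r, t ^ N * χ t :=
    (hPc.mul hF.continuous).sub (hy.continuous.mul hQc)
  have hgreen := hy.isRadialPair.integral_eq_wronskian hF.isRadialPair hφ hF.continuous
    ((hwronskian.tendsto' 0 0 (by simp)).mono_left nhdsWithin_le_nhds)
  obtain ⟨b, hb₁, hb₂⟩ := exists_add_mul_eq (hp.symm.trans hgreen)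
    (hF.integral_ne_zero_of_apply_one_eq_zero hμ hF₀)
  refine ⟨_, _, hy.add_const_mul hF b, hb₁, ?_⟩
  have hψ := hy.continuous_source
  have hχ := hF.continuous_source
  simp only [← hb₂, ← intervalIntegral.integral_const_mul, mul_add, mul_left_comm _ b]
  exact intervalIntegral.integral_add (Continuous.intervalIntegrable (by fun_prop) _ _)
    (Continuous.intervalIntegrable (by fun_prop) _ _)

end RadialPair

section ModePotential

variable {n N : ℕ} {h k ψ : ℝ → ℝ} {r : ℝ}

theorem intervalIntegrable_pow_mul (hψ : ContinuousOn ψ (Icc 0 1)) (N : ℕ) {a b : ℝ}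
    (ha : a ∈ Icc (0 : ℝ) 1) (hb : b ∈ Icc (0 : ℝ) 1) :
    IntervalIntegrable (fun s => s ^ N * ψ s) volume a b :=
  ((continuousOn_pow N).mul (hψ.mono (uIcc_subset_Icc ha hb))).intervalIntegrable

theorem intervalIntegrable_zpow_mul (hψ : ContinuousOn ψ (Icc 0 1)) (m : ℤ)
    (hr : r ∈ Ioc (0 : ℝ) 1) : IntervalIntegrable (fun s => s ^ m * ψ s) volume r 1 := by
  refine (ContinuousOn.mul (fun s hs => ?_)
    (hψ.mono (uIcc_subset_Icc ⟨hr.1.le, hr.2⟩ (right_mem_Icc.2 zero_le_one)))).intervalIntegrable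
  rw [uIcc_of_le hr.2] at hs
  exact (continuousAt_zpow₀ s m (.inl (hr.1.trans_le hs.1).ne')).continuousWithinAt

theorem Hop_congr (hhk : EqOn h k (Icc 0 1)) (n : ℕ) (hr : r ∈ Icc (0 : ℝ) 1) :
    Hop n h r = Hop n k r := by
  rw [Hop, Hop, intervalIntegral_mul_congr hhk hr (right_mem_Icc.2 zero_le_one),
    intervalIntegral_mul_congr hhk (left_mem_Icc.2 zero_le_one) hr]

theorem Hop_one (n : ℕ) (h : ℝ → ℝ) : Hop n h 1 = ∫ s in (0 : ℝ)..1, s ^ (n + 1) * h s := by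
  rw [Hop, intervalIntegral.integral_same, mul_zero, zero_add]

theorem Hop_add_const_mul (hh : ContinuousOn h (Icc 0 1)) (hk : ContinuousOn k (Icc 0 1)) (n : ℕ)
    (C : ℝ) (hr : r ∈ Ioc (0 : ℝ) 1) :
    Hop n (fun s => h s + C * k s) r = Hop n h r + C * Hop n k r := by
  have h₀ : (0 : ℝ) ∈ Icc (0 : ℝ) 1 := left_mem_Icc.2 zero_le_one
  have hr' := Ioc_subset_Icc_self hr
  simp only [Hop, mul_add, mul_left_comm _ C]
  rw [intervalIntegral.integral_add (intervalIntegrable_zpow_mul hh _ hr)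
      ((intervalIntegrable_zpow_mul hk _ hr).const_mul C),
    intervalIntegral.integral_add (intervalIntegrable_pow_mul hh _ h₀ hr')
      ((intervalIntegrable_pow_mul hk _ h₀ hr').const_mul C),
    intervalIntegral.integral_const_mul, intervalIntegral.integral_const_mul]
  ring

theorem pow_succ_mul_pow_mul (n : ℕ) (ψ : ℝ → ℝ) (s : ℝ) :
    s ^ (n + 1) * (s ^ n * ψ s) = s ^ (2 * n + 1) * ψ s := by
  ring

theorem Hop_pow_mul (n : ℕ) (ψ : ℝ → ℝ) (hr : r ∈ Ioc (0 : ℝ) 1) :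
    Hop n (fun s => s ^ n * ψ s) r
      = r ^ (2 * n) * (∫ s in r..1, s * ψ s) + ∫ s in (0 : ℝ)..r, s ^ (2 * n + 1) * ψ s := by
  have hcancel : ∀ s ∈ uIcc r 1, s ^ (1 - (n : ℤ)) * (s ^ n * ψ s) = s * ψ s := fun s hs => by
    rw [uIcc_of_le hr.2] at hs
    have hs₀ : s ≠ 0 := (hr.1.trans_le hs.1).ne'
    rw [zpow_one_sub_natCast₀ hs₀]
    field_simp
  simp only [Hop, pow_succ_mul_pow_mul, intervalIntegral.integral_congr hcancel]

theorem hasDerivAt_integral_zpow_mul (hh : Continuous h) (m : ℤ) (hr : 0 < r) :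
    HasDerivAt (fun r => ∫ s in r..1, s ^ m * h s) (-(r ^ m * h r)) r := by
  have hcont : ContinuousOn (fun s : ℝ => s ^ m * h s) (Ioi 0) :=
    ((continuousOn_zpow₀ m).mono fun s (hs : 0 < s) => hs.ne').mul hh.continuousOn
  exact intervalIntegral.integral_hasDerivAt_left
    (hcont.mono fun s hs => (lt_min hr one_pos).trans_le hs.1).intervalIntegrable
    (hcont.stronglyMeasurableAtFilter isOpen_Ioi r hr) (hcont.continuousAt (Ioi_mem_nhds hr))

theorem abs_integral_zpow_mul_le {B : ℝ} (hB : ∀ t ∈ Icc (0 : ℝ) 1, |h t| ≤ B) (n : ℕ)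
    (hr : r ∈ Ioc (0 : ℝ) 1) : |∫ s in r..1, s ^ (1 - (n : ℤ)) * h s| ≤ B / r ^ n := by
  have hr₀ := hr.1
  have hB₀ : 0 ≤ B := (abs_nonneg _).trans (hB 0 (left_mem_Icc.2 zero_le_one))
  have hbound : ∀ s ∈ uIoc r 1, ‖s ^ (1 - (n : ℤ)) * h s‖ ≤ B / r ^ n := fun s hs => by
    rw [uIoc_of_le hr.2] at hs
    have hs₀ : 0 < s := hr₀.trans hs.1
    rw [Real.norm_eq_abs, abs_mul, abs_of_pos (zpow_pos hs₀ _), zpow_one_sub_natCast₀ hs₀.ne']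
    calc s / s ^ n * |h s| ≤ 1 / r ^ n * B := by
          gcongr
          · exact hs.2
          · exact hs.1.le
          · exact hB s ⟨hs₀.le, hs.2⟩
      _ = B / r ^ n := one_div_mul_eq_div _ _
  rw [← Real.norm_eq_abs]
  refine (intervalIntegral.norm_integral_le_of_norm_le_const hbound).trans
    (mul_le_of_le_one_right (by positivity) ?_)
  rw [abs_of_nonneg (sub_nonneg.2 hr.2)]
  exact sub_le_self 1 hr₀.le

theorem tendsto_Hop_zero (hh : Continuous h) (hn : n ≠ 0) : Tendsto (Hop n h) (𝓝[>] 0) (𝓝 0) := by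
  obtain ⟨B, hB⟩ := isCompact_Icc.exists_bound_of_continuousOn hh.continuousOn (s := Icc (0 : ℝ) 1)
  have houter : Tendsto (fun r => r ^ (2 * n) * ∫ s in r..1, s ^ (1 - (n : ℤ)) * h s)
      (𝓝[>] 0) (𝓝 0) := by
    refine squeeze_zero_norm' (a := fun r => r ^ n * B) ?_ <|
      ((continuous_pow n).mul continuous_const).tendsto' 0 0 (by simp [hn])
        |>.mono_left nhdsWithin_le_nhds
    filter_upwards [Ioc_mem_nhdsGT one_pos] with r hr
    have hr₀ := hr.1
    rw [Real.norm_eq_abs, abs_mul, abs_of_pos (by positivity)]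
    calc r ^ (2 * n) * |∫ s in r..1, s ^ (1 - (n : ℤ)) * h s| ≤ r ^ (2 * n) * (B / r ^ n) := by
          gcongr
          exact abs_integral_zpow_mul_le hB n hr
      _ = r ^ n * B := by
          field_simp
          ring
  have hinner := ((continuous_integral_pow_mul (n + 1) hh).tendsto' 0 0 (by simp)).mono_left
    (nhdsWithin_le_nhds (s := Ioi 0))
  have hsum := houter.add hinner
  rwa [add_zero] at hsum

/-- The solution `A = -H_n[k] / (2n r^{2n})` of `(r^{2n+1} A')' = r^{n+1} k`. -/
def modePotential (n : ℕ) (k : ℝ → ℝ) (r : ℝ) : ℝ := -Hop n k r / (2 * n * r ^ (2 * n))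

theorem hasDerivAt_modePotential (hk : Continuous k) (hn : n ≠ 0) (hr : 0 < r) :
    HasDerivAt (modePotential n k)
      ((∫ s in (0 : ℝ)..r, s ^ (n + 1) * k s) / r ^ (2 * n + 1)) r := by
  have hr₀ : r ≠ 0 := hr.ne'
  have hn₀ : (n : ℝ) ≠ 0 := Nat.cast_ne_zero.2 hn
  have hpow := hasDerivAt_pow (2 * n) r
  have hHop := (hpow.mul (hasDerivAt_integral_zpow_mul hk (1 - n) hr)).add
    (hasDerivAt_integral_pow_mul (n + 1) hk r)
  refine (hHop.neg.div (hpow.const_mul (2 * n : ℝ)) (by positivity)).congr_deriv ?_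
  obtain ⟨m, rfl⟩ := Nat.exists_eq_add_one_of_ne_zero hn
  rw [zpow_one_sub_natCast₀ hr₀]
  simp only [Pi.neg_apply, Pi.add_apply, Pi.mul_apply, Nat.mul_succ]
  push_cast at hn₀ ⊢
  field_simp
  ring

theorem modePotential_pow_mul (hψ : Continuous ψ) (hn : n ≠ 0) (hr : 0 < r) :
    modePotential n (fun s => s ^ n * ψ s) r = radialInt (2 * n + 1) ψ r
      - radialInt (2 * n + 1) ψ 1 - (∫ s in (0 : ℝ)..1, s ^ (2 * n + 1) * ψ s) / (2 * n) := by
  have hderiv : ∀ t ∈ Ioi (0 : ℝ), HasDerivAt (fun r => modePotential n (fun s => s ^ n * ψ s) r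
      - radialInt (2 * n + 1) ψ r) 0 t := fun t (ht : 0 < t) => by
    refine ((hasDerivAt_modePotential (by fun_prop) hn ht).sub
      (hasDerivAt_radialInt (2 * n + 1) hψ t)).congr_deriv ?_
    simp only [pow_succ_mul_pow_mul, mul_radialMean ht.ne', sub_self]
  have hconst := isOpen_Ioi.is_const_of_deriv_eq_zero isPreconnected_Ioi
    (fun t ht => (hderiv t ht).differentiableAt.differentiableWithinAt)
    (fun t ht => (hderiv t ht).deriv) hr (mem_Ioi.2 one_pos)
  have hone : modePotential n (fun s => s ^ n * ψ s) 1
      = -(∫ s in (0 : ℝ)..1, s ^ (2 * n + 1) * ψ s) / (2 * n) := by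
    simp only [modePotential, Hop_one, pow_succ_mul_pow_mul, one_pow, mul_one]
  rw [hone] at hconst
  linear_combination hconst

theorem tendsto_pow_mul_modePotential_zero (hk : Continuous k) (hn : n ≠ 0) :
    Tendsto (fun r => r ^ (2 * n) * modePotential n k r) (𝓝[>] 0) (𝓝 0) := by
  have hlim := (tendsto_Hop_zero hk hn).neg.div_const (2 * n : ℝ)
  rw [neg_zero, zero_div] at hlim
  refine hlim.congr' ?_
  filter_upwards [self_mem_nhdsWithin] with r (hr : 0 < r)
  rw [modePotential]
  field_simp

end ModePotential

section KernelEquation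

variable {f₀ f h k μ χ F F' : ℝ → ℝ} {n : ℕ} {Ω C r : ℝ}

/-- The coefficient `Ω - n/(n+1) ∫₀¹ s f₀(s) ds` of `F(1)` in the dispersion function. -/
def boundaryCoeff (f₀ : ℝ → ℝ) (n : ℕ) (Ω : ℝ) : ℝ :=
  Ω - (n : ℝ) / (n + 1) * ∫ s in (0 : ℝ)..1, s * f₀ s

/-- The dispersion function with the regular solution `F` as a free argument: `ζ_n(Ω)` is its value
at `F = F_{n,Ω}`. -/
def dispersion (f₀ : ℝ → ℝ) (n : ℕ) (Ω : ℝ) (F : ℝ → ℝ) : ℝ :=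
  F 1 * boundaryCoeff f₀ n Ω + ∫ s in (0 : ℝ)..1, F s * s ^ (2 * n + 1) * (f₀ s - 2 * Ω)

/-- The function `w` for which the kernel equation reads `h = -μ r^n w`, when the factor
`H_n[h](1) / G_n(1)` in front of `G_n` is replaced by a free constant `-C / (n + 1)`. It solves
`(r^(2n+1) w')' = r^(n+1) (h + C r^n (f₀ - 2Ω))`. -/
def kernelAmplitude (f₀ : ℝ → ℝ) (Ω : ℝ) (n : ℕ) (C : ℝ) (h : ℝ → ℝ) (r : ℝ) : ℝ :=
  modePotential n (fun s => h s + C * (s ^ n * (f₀ s - 2 * Ω))) r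
    - C * boundaryCoeff f₀ n Ω / (2 * n)

theorem boundaryCoeff_congr (hf : EqOn f f₀ (Icc 0 1)) (n : ℕ) (Ω : ℝ) :
    boundaryCoeff f n Ω = boundaryCoeff f₀ n Ω := by
  rw [boundaryCoeff, boundaryCoeff, intervalIntegral_mul_congr hf (left_mem_Icc.2 zero_le_one)
    (right_mem_Icc.2 zero_le_one)]

theorem dispersion_congr (hf : EqOn f f₀ (Icc 0 1)) (hF : EqOn F F' (Icc 0 1)) (n : ℕ) (Ω : ℝ) :
    dispersion f n Ω F = dispersion f₀ n Ω F' := by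
  rw [dispersion, dispersion, boundaryCoeff_congr hf, hF (right_mem_Icc.2 zero_le_one)]
  congr 1
  refine intervalIntegral.integral_congr fun s hs => ?_
  rw [uIcc_of_le zero_le_one] at hs
  simp only [hf hs, hF hs]

theorem kernelAmplitude_congr (hf : EqOn f f₀ (Icc 0 1)) (hh : EqOn h k (Icc 0 1)) (Ω : ℝ) (n : ℕ)
    (C : ℝ) (hr : r ∈ Icc (0 : ℝ) 1) :
    kernelAmplitude f Ω n C h r = kernelAmplitude f₀ Ω n C k r := by
  rw [kernelAmplitude, kernelAmplitude, modePotential, modePotential, boundaryCoeff_congr hf,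
    Hop_congr (k := fun s => k s + C * (s ^ n * (f₀ s - 2 * Ω)))
      (fun s hs => by simp only [hf hs, hh hs]) n hr]

theorem integral_pow_mul_sub_const (hf₀ : ContinuousOn f₀ (Icc 0 1)) (N : ℕ) (c : ℝ) {a b : ℝ}
    (ha : a ∈ Icc (0 : ℝ) 1) (hb : b ∈ Icc (0 : ℝ) 1) :
    ∫ s in a..b, s ^ N * (f₀ s - c)
      = (∫ s in a..b, s ^ N * f₀ s) - (b ^ (N + 1) - a ^ (N + 1)) / (N + 1) * c := by
  simp only [mul_sub]
  rw [intervalIntegral.integral_sub (intervalIntegrable_pow_mul hf₀ N ha hb)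
    ((continuous_pow N).mul_const c |>.intervalIntegrable a b),
    intervalIntegral.integral_mul_const, integral_pow]

theorem pow_mul_Gfun (hf₀ : ContinuousOn f₀ (Icc 0 1)) (hn : n ≠ 0) (hr : r ∈ Ioc (0 : ℝ) 1) :
    r ^ (n + 1) * Gfun f₀ Ω n r = (n + 1) * (Hop n (fun s => s ^ n * (f₀ s - 2 * Ω)) r
      + boundaryCoeff f₀ n Ω * r ^ (2 * n)) := by
  have hr₀ : r ≠ 0 := hr.1.ne'
  have h₀ : (0 : ℝ) ∈ Icc (0 : ℝ) 1 := left_mem_Icc.2 zero_le_one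
  have h₁ : (1 : ℝ) ∈ Icc (0 : ℝ) 1 := right_mem_Icc.2 zero_le_one
  have hr' := Ioc_subset_Icc_self hr
  have houter := integral_pow_mul_sub_const hf₀ 1 (2 * Ω) hr' h₁
  have hsplit := intervalIntegral.integral_add_adjacent_intervals
    (intervalIntegrable_pow_mul hf₀ 1 h₀ hr') (intervalIntegrable_pow_mul hf₀ 1 hr' h₁)
  simp only [pow_one] at houter hsplit
  rw [Hop_pow_mul n _ hr, houter, integral_pow_mul_sub_const hf₀ _ _ h₀ hr', Gfun, boundaryCoeff,
    ← hsplit]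
  obtain ⟨m, rfl⟩ := Nat.exists_eq_add_one_of_ne_zero hn
  simp only [Nat.add_sub_cancel]
  push_cast
  field_simp
  ring

theorem Gfun_one (f₀ : ℝ → ℝ) (Ω : ℝ) (hn : n ≠ 0) :
    Gfun f₀ Ω n 1 = n * (Ω - omegaHat f₀ n) := by
  have hn₀ : (n : ℝ) ≠ 0 := Nat.cast_ne_zero.2 hn
  simp only [Gfun, omegaHat, one_pow]
  field_simp
  ring

theorem two_mul_pow_mul_kernelAmplitude (hf₀ : ContinuousOn f₀ (Icc 0 1))
    (hh : ContinuousOn h (Icc 0 1)) (hn : n ≠ 0) (hr : r ∈ Ioc (0 : ℝ) 1) :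
    2 * n * r ^ (2 * n) * kernelAmplitude f₀ Ω n C h r
      = -(Hop n h r + C / (n + 1) * (r ^ (n + 1) * Gfun f₀ Ω n r)) := by
  have hr₀ : r ≠ 0 := hr.1.ne'
  have hk : ContinuousOn (fun s => s ^ n * (f₀ s - 2 * Ω)) (Icc 0 1) := by fun_prop
  rw [pow_mul_Gfun hf₀ hn hr, kernelAmplitude, modePotential, Hop_add_const_mul hh hk n C hr]
  field_simp
  ring

theorem solvesKernelEq_iff (hf₀ : ContinuousOn f₀ (Icc 0 1)) (hh : ContinuousOn h (Icc 0 1))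
    (hn : n ≠ 0) (hG : Gfun f₀ Ω n 1 ≠ 0) :
    SolvesKernelEq f₀ Ω n h ↔ ∃ C, kernelAmplitude f₀ Ω n C h 1 = 0 ∧
      ∀ r ∈ Ioc (0 : ℝ) 1, h r = -(mu f₀ Ω r * r ^ n * kernelAmplitude f₀ Ω n C h r) := by
  have hn₀ : (n : ℝ) ≠ 0 := Nat.cast_ne_zero.2 hn
  have hone (C : ℝ) :
      kernelAmplitude f₀ Ω n C h 1 = 0 ↔ C = -((n + 1) * (Hop n h 1 / Gfun f₀ Ω n 1)) := by
    have hamp := two_mul_pow_mul_kernelAmplitude (Ω := Ω) (C := C) hf₀ hh hn ⟨one_pos, le_rfl⟩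
    simp only [one_pow, mul_one, one_mul] at hamp
    rw [← mul_right_inj' (mul_ne_zero two_ne_zero hn₀), hamp, mul_zero]
    field_simp
    grind
  simp only [hone, exists_eq_left, SolvesKernelEq]
  refine forall₂_congr fun r hr => ?_
  have hr₀ : r ≠ 0 := hr.1.ne'
  have hamp := two_mul_pow_mul_kernelAmplitude (Ω := Ω)
    (C := -((n + 1) * (Hop n h 1 / Gfun f₀ Ω n 1))) hf₀ hh hn hr
  rw [mul_comm, ← eq_div_iff (by positivity)] at hamp
  rw [hamp, sub_eq_iff_eq_add]
  refine Eq.congr_right ?_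
  field_simp
  ring

theorem integral_eq_of_kernelAmplitude_one (hn : n ≠ 0) (hw : kernelAmplitude f Ω n C h 1 = 0) :
    ∫ s in (0 : ℝ)..1, s ^ (n + 1) * (h s + C * (s ^ n * (f s - 2 * Ω)))
      = -(C * boundaryCoeff f n Ω) := by
  have hn₀ : (n : ℝ) ≠ 0 := Nat.cast_ne_zero.2 hn
  rw [kernelAmplitude, modePotential, Hop_one, one_pow, mul_one, ← sub_div, div_eq_zero_iff,
    or_iff_left (mul_ne_zero two_ne_zero hn₀)] at hw
  linear_combination -hw

theorem isRadialPair_kernelAmplitude (hf : Continuous f) (hh : Continuous h) (hn : n ≠ 0)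
    (heq : ∀ r ∈ Ioc (0 : ℝ) 1, h r = -(μ r * r ^ n * kernelAmplitude f Ω n C h r)) :
    IsRadialPair (2 * n + 1) μ (fun r => C * (f r - 2 * Ω)) (kernelAmplitude f Ω n C h)
      fun r => ∫ s in (0 : ℝ)..r, s ^ (n + 1) * (h s + C * (s ^ n * (f s - 2 * Ω))) where
  hasDerivAt_fst r hr := (hasDerivAt_modePotential (by fun_prop) hn hr.1).sub_const _
  hasDerivAt_snd r hr := by
    refine (hasDerivAt_integral_pow_mul (n + 1) (by fun_prop) r).congr_deriv ?_
    rw [heq r hr]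
    ring

theorem tendsto_pow_mul_kernelAmplitude_zero (hf : Continuous f) (hh : Continuous h) (hn : n ≠ 0) :
    Tendsto (fun r => r ^ (2 * n) * kernelAmplitude f Ω n C h r) (𝓝[>] 0) (𝓝 0) := by
  have hconst : Tendsto (fun r : ℝ => r ^ (2 * n) * (C * boundaryCoeff f n Ω / (2 * n)))
      (𝓝[>] 0) (𝓝 0) :=
    (((continuous_pow (2 * n)).mul_const _).tendsto' 0 0 (by simp [hn])).mono_left
      nhdsWithin_le_nhds
  have hlim := (tendsto_pow_mul_modePotential_zero
    (k := fun s => h s + C * (s ^ n * (f s - 2 * Ω))) (by fun_prop) hn).sub hconst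
  simpa only [kernelAmplitude, mul_sub, sub_zero] using hlim

theorem const_mul_dispersion_eq_zero (hf : Continuous f) (hh : Continuous h) (hn : n ≠ 0)
    (hF : IsRadialSolution (2 * n + 1) μ 0 χ F) (hw : kernelAmplitude f Ω n C h 1 = 0)
    (heq : ∀ r ∈ Ioc (0 : ℝ) 1, h r = -(μ r * r ^ n * kernelAmplitude f Ω n C h r)) :
    C * dispersion f n Ω F = 0 := by
  have hP : Continuous fun r => ∫ s in (0 : ℝ)..r,
      s ^ (n + 1) * (h s + C * (s ^ n * (f s - 2 * Ω))) :=
    continuous_integral_pow_mul (n + 1) (by fun_prop)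
  have hmean := continuous_radialMean (2 * n + 1) hF.continuous_source
  have hQ : Tendsto (fun r => r ^ 2 * radialMean (2 * n + 1) χ r) (𝓝[>] 0) (𝓝 0) :=
    (((continuous_pow 2).mul hmean).tendsto' 0 0 (by simp)).mono_left nhdsWithin_le_nhds
  have hlim := (((hP.mul hF.continuous).tendsto' 0 0 (by simp)).mono_left
    nhdsWithin_le_nhds).sub ((tendsto_pow_mul_kernelAmplitude_zero (Ω := Ω) (C := C)
      hf hh hn).mul hQ)
  rw [mul_zero, sub_zero] at hlim
  have hgreen := (isRadialPair_kernelAmplitude hf hh hn heq).integral_eq_wronskian hF.isRadialPair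
    (by fun_prop) hF.continuous <| hlim.congr fun r => by
      rw [Pi.mul_apply, ← pow_mul_radialMean (2 * n + 1)]
      ring
  rw [integral_eq_of_kernelAmplitude_one hn hw, hw, zero_mul, sub_zero] at hgreen
  have hpull : ∫ s in (0 : ℝ)..1, s ^ (2 * n + 1) * (C * (f s - 2 * Ω)) * F s
      = C * ∫ s in (0 : ℝ)..1, F s * s ^ (2 * n + 1) * (f s - 2 * Ω) := by
    rw [← intervalIntegral.integral_const_mul]
    congr 1
    ext s
    ring
  rw [dispersion]
  linear_combination hgreen - hpull

theorem eqOn_zero_of_dispersion_ne_zero (hf : Continuous f) (hh : Continuous h) (hμ : Continuous μ)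
    (hn : n ≠ 0) (hF : IsRadialSolution (2 * n + 1) μ 0 χ F) (hζ : dispersion f n Ω F ≠ 0)
    (hw : kernelAmplitude f Ω n C h 1 = 0)
    (heq : ∀ r ∈ Ioc (0 : ℝ) 1, h r = -(μ r * r ^ n * kernelAmplitude f Ω n C h r)) :
    EqOn h 0 (Icc 0 1) := by
  obtain rfl : C = 0 :=
    (mul_eq_zero.1 (const_mul_dispersion_eq_zero hf hh hn hF hw heq)).resolve_right hζ
  have hpair := isRadialPair_kernelAmplitude hf hh hn heq
  have hP₁ := integral_eq_of_kernelAmplitude_one hn hw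
  simp only [zero_mul, neg_zero] at hpair hP₁
  have hzero : EqOn h 0 (Ioc 0 1) := fun r hr => by
    rw [heq r hr, hpair.eqOn_zero hμ hw (by simpa using hP₁) hr]
    simp
  rw [← closure_Ioc zero_ne_one]
  exact hzero.closure hh continuous_const

theorem exists_kernelAmplitude_of_dispersion_eq_zero (hf : Continuous f) (hμ : Continuous μ)
    (hn : n ≠ 0) (hF : IsRadialSolution (2 * n + 1) μ 0 χ F) (hF₀ : F 0 ≠ 0)
    (hζ : dispersion f n Ω F = 0) :
    ∃ h, Continuous h ∧ kernelAmplitude f Ω n 1 h 1 = 0 ∧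
      ∀ r ∈ Ioc (0 : ℝ) 1, h r = -(μ r * r ^ n * kernelAmplitude f Ω n 1 h r) := by
  have hcompat : ∫ s in (0 : ℝ)..1, s ^ (2 * n + 1) * (f s - 2 * Ω) * F s
      = -boundaryCoeff f n Ω * F 1 := by
    simp only [mul_comm _ (F _), ← mul_assoc]
    rw [dispersion] at hζ
    linear_combination hζ
  obtain ⟨ψ, w, hw, hw₁, hP⟩ := hF.exists_of_integral_eq (by fun_prop) hμ hF₀ hcompat
  have hψ := hw.continuous_source
  have hwc := hw.continuous
  have hsource : EqOn (fun s => -(μ s * s ^ n * w s) + 1 * (s ^ n * (f s - 2 * Ω)))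
      (fun s => s ^ n * ψ s) (Icc 0 1) := fun s hs => by
    simp only [hw.source_eq s hs]
    ring
  have hamp : ∀ r ∈ Ioc (0 : ℝ) 1,
      kernelAmplitude f Ω n 1 (fun s => -(μ s * s ^ n * w s)) r = w r := fun r hr => by
    rw [kernelAmplitude, modePotential, Hop_congr hsource n (Ioc_subset_Icc_self hr),
      ← modePotential, modePotential_pow_mul hψ hn hr.1, hP, hw.eq_add_radialInt r]
    linear_combination hw.eq_add_radialInt 1 - hw₁
  refine ⟨fun s => -(μ s * s ^ n * w s), by fun_prop, ?_, fun r hr => ?_⟩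
  · rw [hamp 1 ⟨one_pos, le_rfl⟩, hw₁]
  · rw [hamp r hr]

theorem exists_solvesKernelEq_iff (hf₀ : ContinuousOn f₀ (Icc 0 1)) (hμ : Continuous μ)
    (hmu : EqOn (mu f₀ Ω) μ (Ioc 0 1)) (hn : n ≠ 0) (hG : Gfun f₀ Ω n 1 ≠ 0)
    (hF : IsRadialSolution (2 * n + 1) μ 0 χ F) (hF₀ : F 0 ≠ 0) :
    (∃ h, ContinuousOn h (Icc 0 1) ∧ (∃ r ∈ Icc (0 : ℝ) 1, h r ≠ 0) ∧ SolvesKernelEq f₀ Ω n h)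
      ↔ dispersion f₀ n Ω F = 0 := by
  have h₁ : (1 : ℝ) ∈ Ioc (0 : ℝ) 1 := ⟨one_pos, le_rfl⟩
  obtain ⟨f, hf, hff₀⟩ := exists_continuous_eqOn_Icc zero_le_one hf₀
  rw [← dispersion_congr hff₀ (fun _ _ => rfl)]
  constructor
  · rintro ⟨h, hh, ⟨r, hr, hhr⟩, hsol⟩
    obtain ⟨C, hw, heq⟩ := (solvesKernelEq_iff hf₀ hh hn hG).1 hsol
    obtain ⟨k, hk, hkh⟩ := exists_continuous_eqOn_Icc zero_le_one hh
    have hcongr : ∀ t ∈ Ioc (0 : ℝ) 1,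
        kernelAmplitude f Ω n C k t = kernelAmplitude f₀ Ω n C h t := fun t ht =>
      kernelAmplitude_congr hff₀ hkh Ω n C (Ioc_subset_Icc_self ht)
    by_contra hζ
    refine hhr ((hkh hr).symm.trans (eqOn_zero_of_dispersion_ne_zero (C := C) hf hk hμ hn hF hζ
      ((hcongr 1 h₁).trans hw) (fun t ht => ?_) hr))
    rw [hcongr t ht, hkh (Ioc_subset_Icc_self ht), heq t ht, hmu ht]
  · intro hζ
    obtain ⟨h, hh, hw, heq⟩ := exists_kernelAmplitude_of_dispersion_eq_zero hf hμ hn hF hF₀ hζ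
    have hcongr : ∀ t ∈ Ioc (0 : ℝ) 1,
        kernelAmplitude f Ω n 1 h t = kernelAmplitude f₀ Ω n 1 h t := fun t ht =>
      kernelAmplitude_congr hff₀ (fun _ _ => rfl) Ω n 1 (Ioc_subset_Icc_self ht)
    rw [hcongr 1 h₁] at hw
    refine ⟨h, hh.continuousOn, ?_, (solvesKernelEq_iff hf₀ hh.continuousOn hn hG).2
      ⟨1, hw, fun t ht => by rw [hmu ht, ← hcongr t ht, ← heq t ht]⟩⟩
    by_contra! hzero
    have hamp := two_mul_pow_mul_kernelAmplitude (Ω := Ω) (C := 1) hf₀ hh.continuousOn hn h₁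
    rw [hw, Hop_congr (k := 0) (fun t ht => hzero t ht) n (Ioc_subset_Icc_self h₁), Hop_one] at hamp
    simp only [Pi.zero_apply, mul_zero, intervalIntegral.integral_zero] at hamp
    refine hG ?_
    field_simp at hamp
    simpa using hamp.symm

end KernelEquation

section RegularSolution

variable {f₀ g μ ψ F F' : ℝ → ℝ} {n N : ℕ} {Ω r : ℝ}

theorem mapsTo_sq_Icc : MapsTo (fun r : ℝ => r ^ 2) (Icc 0 1) (Icc 0 1) := fun _ hr =>
  ⟨sq_nonneg _, pow_le_one₀ hr.1 hr.2⟩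

theorem continuousOn_of_eq_comp_sq (hg : ContinuousOn g (Icc 0 1))
    (hfg : ∀ r ∈ Icc (0 : ℝ) 1, f₀ r = g (r ^ 2)) : ContinuousOn f₀ (Icc 0 1) :=
  (hg.comp (continuousOn_pow 2) mapsTo_sq_Icc).congr hfg

theorem profileMean_eq_radialMean (f₀ : ℝ → ℝ) : profileMean f₀ = radialMean 1 f₀ := by
  ext r
  simp only [profileMean, radialMean, pow_one]

theorem continuousOn_profileMean (hf₀ : ContinuousOn f₀ (Icc 0 1)) :
    ContinuousOn (profileMean f₀) (Icc 0 1) := by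
  obtain ⟨f, hf, hff₀⟩ := exists_continuous_eqOn_Icc zero_le_one hf₀
  rw [profileMean_eq_radialMean]
  exact (continuous_radialMean 1 hf).continuousOn.congr fun r hr => (radialMean_congr hff₀ hr).symm

theorem sub_profileMean_ne_zero (hf₀ : ContinuousOn f₀ (Icc 0 1))
    (hΩ : Ω ∉ Icc (kappa₁ f₀) (kappa₂ f₀)) (hr : r ∈ Icc (0 : ℝ) 1) : Ω - profileMean f₀ r ≠ 0 := by
  have himage := isCompact_Icc.image_of_continuousOn (continuousOn_profileMean hf₀)
  intro hzero
  rw [sub_eq_zero.1 hzero] at hΩ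
  exact hΩ ⟨csInf_le himage.bddBelow (mem_image_of_mem _ hr),
    le_csSup himage.bddAbove (mem_image_of_mem _ hr)⟩

theorem derivWithin_of_eq_comp_sq (hg : DifferentiableOn ℝ g (Icc 0 1))
    (hfg : ∀ r ∈ Icc (0 : ℝ) 1, f₀ r = g (r ^ 2)) (hr : r ∈ Icc (0 : ℝ) 1) :
    derivWithin f₀ (Icc 0 1) r = derivWithin g (Icc 0 1) (r ^ 2) * (2 * r) := by
  have hsq : HasDerivWithinAt (fun r : ℝ => r ^ 2) (2 * r) (Icc 0 1) r := by
    simpa using (hasDerivAt_pow 2 r).hasDerivWithinAt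
  have hcomp := HasDerivWithinAt.comp (h := fun r : ℝ => r ^ 2) r
    (hg _ (mapsTo_sq_Icc hr)).hasDerivWithinAt hsq mapsTo_sq_Icc
  exact (hcomp.congr hfg (hfg r hr)).derivWithin (uniqueDiffOn_Icc zero_lt_one r hr)

theorem exists_continuous_eqOn_mu (hg : ContDiffOn ℝ 1 g (Icc 0 1))
    (hfg : ∀ r ∈ Icc (0 : ℝ) 1, f₀ r = g (r ^ 2)) (hΩ : Ω ∉ Icc (kappa₁ f₀) (kappa₂ f₀)) :
    ∃ μ, Continuous μ ∧ EqOn (mu f₀ Ω) μ (Ioc 0 1) := by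
  have hf₀ := continuousOn_of_eq_comp_sq hg.continuousOn hfg
  have hcont : ContinuousOn
      (fun r => 2 * derivWithin g (Icc 0 1) (r ^ 2) / (Ω - profileMean f₀ r)) (Icc 0 1) :=
    (continuousOn_const.mul ((hg.continuousOn_derivWithin (uniqueDiffOn_Icc zero_lt_one)
      le_rfl).comp (continuousOn_pow 2) mapsTo_sq_Icc)).div
      (continuousOn_const.sub (continuousOn_profileMean hf₀))
      fun r hr => sub_profileMean_ne_zero hf₀ hΩ hr
  obtain ⟨μ, hμ, hμeq⟩ := exists_continuous_eqOn_Icc zero_le_one hcont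
  refine ⟨μ, hμ, fun r hr => ?_⟩
  have hr' := Ioc_subset_Icc_self hr
  have hr₀ : r ≠ 0 := hr.1.ne'
  have hne := sub_profileMean_ne_zero hf₀ hΩ hr'
  rw [hμeq hr', mu, derivWithin_of_eq_comp_sq (hg.differentiableOn one_ne_zero) hfg hr']
  field_simp

theorem IsRadialSolution.isRegularSolution (hmu : EqOn (mu f₀ Ω) μ (Ioc 0 1))
    (hF : IsRadialSolution (2 * n + 1) μ 0 ψ F) (hF₀ : F 0 = 1) : IsRegularSolution f₀ n Ω F where
  contDiffOn := by
    rw [funext hF.eq_add_radialInt]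
    exact (contDiff_const.add (contDiff_two_radialInt _ hF.continuous_source)).contDiffOn
  init := hF₀
  ode r hr := by
    have hunique := uniqueDiffOn_Icc (zero_lt_one' ℝ)
    have hr' := Ioc_subset_Icc_self hr
    have hr₀ : r ≠ 0 := hr.1.ne'
    have hderiv : EqOn (derivWithin F (Icc 0 1)) (fun r => r * radialMean (2 * n + 1) ψ r)
        (Icc 0 1) := fun t ht => (hF.hasDerivAt t).hasDerivWithinAt.derivWithin (hunique t ht)
    have hderiv₂ := (hasDerivAt_mul_radialMean (2 * n + 1) hF.continuous_source
      r).hasDerivWithinAt.derivWithin (hunique r hr')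
    rw [derivWithin_congr hderiv (hderiv hr'), hderiv hr', hderiv₂, hmu hr, hF.source_eq r hr',
      Pi.zero_apply]
    push_cast
    field_simp
    ring

theorem hasDerivAt_derivWithin_Icc {a b : ℝ} (hF : DifferentiableOn ℝ F (Icc a b))
    (hr : r ∈ Ioo a b) : HasDerivAt F (derivWithin F (Icc a b) r) r :=
  (hF r (Ioo_subset_Icc_self hr)).hasDerivWithinAt.hasDerivAt (Icc_mem_nhds hr.1 hr.2)

theorem derivWithin_eq_mul_radialMean (hF : ContDiffOn ℝ 2 F (Icc 0 1)) (hψ : Continuous ψ)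
    (hode : ∀ r ∈ Ioo (0 : ℝ) 1, derivWithin (derivWithin F (Icc 0 1)) (Icc 0 1) r
      + N / r * derivWithin F (Icc 0 1) r = ψ r) (hN : N ≠ 0) (hr : r ∈ Ioc (0 : ℝ) 1) :
    derivWithin F (Icc 0 1) r = r * radialMean N ψ r := by
  have hD : ContDiffOn ℝ 1 (derivWithin F (Icc 0 1)) (Icc 0 1) :=
    hF.derivWithin (uniqueDiffOn_Icc zero_lt_one) one_add_one_eq_two.le
  have hderiv : ∀ t ∈ Ioo 0 r,
      HasDerivAt (fun t => t ^ N * derivWithin F (Icc 0 1) t) (t ^ N * ψ t) t := fun t ht => by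
    have ht' : t ∈ Ioo (0 : ℝ) 1 := ⟨ht.1, ht.2.trans_le hr.2⟩
    have ht₀ : t ≠ 0 := ht.1.ne'
    refine ((hasDerivAt_pow N t).mul (hasDerivAt_derivWithin_Icc
      (hD.differentiableOn one_ne_zero) ht')).congr_deriv ?_
    rw [← hode t ht']
    obtain ⟨M, rfl⟩ := Nat.exists_eq_add_one_of_ne_zero hN
    simp only [Nat.add_sub_cancel]
    field_simp
    ring
  have hftc := intervalIntegral.integral_eq_sub_of_hasDerivAt_of_le hr.1.le
    ((continuousOn_pow N).mul (hD.continuousOn.mono (Icc_subset_Icc_right hr.2))) hderiv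
    (Continuous.intervalIntegrable (by fun_prop) _ _)
  rw [mul_radialMean hr.1.ne', hftc, Pi.mul_apply, Pi.mul_apply, zero_pow hN, zero_mul, sub_zero,
    mul_div_cancel_left₀ _ (pow_ne_zero N hr.1.ne')]

theorem eq_add_radialInt_of_contDiffOn (hF : ContDiffOn ℝ 2 F (Icc 0 1)) (hψ : Continuous ψ)
    (hode : ∀ r ∈ Ioo (0 : ℝ) 1, derivWithin (derivWithin F (Icc 0 1)) (Icc 0 1) r
      + N / r * derivWithin F (Icc 0 1) r = ψ r) (hN : N ≠ 0) (hr : r ∈ Icc (0 : ℝ) 1) :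
    F r = F 0 + radialInt N ψ r := by
  have hftc := intervalIntegral.integral_eq_sub_of_hasDerivAt_of_le hr.1
    (hF.continuousOn.mono (Icc_subset_Icc_right hr.2)) (fun t ht => by
      have ht' : t ∈ Ioo (0 : ℝ) 1 := ⟨ht.1, ht.2.trans_le hr.2⟩
      have hderiv := hasDerivAt_derivWithin_Icc (hF.differentiableOn two_ne_zero) ht'
      rwa [derivWithin_eq_mul_radialMean hF hψ hode hN (Ioo_subset_Ioc_self ht')] at hderiv)
    ((continuous_id.mul (continuous_radialMean N hψ)).intervalIntegrable _ _)
  rw [radialInt, add_comm, ← sub_eq_iff_eq_add]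
  exact hftc.symm

theorem IsRegularSolution.eq_add_radialInt (hF : IsRegularSolution f₀ n Ω F) (hμ : Continuous μ)
    (hmu : EqOn (mu f₀ Ω) μ (Ioc 0 1)) (hr : r ∈ Icc (0 : ℝ) 1) :
    F r = 1 + radialInt (2 * n + 1) (fun t => (0 : ℝ → ℝ) t - μ t * F t) r := by
  obtain ⟨k, hk, hkF⟩ := exists_continuous_eqOn_Icc zero_le_one hF.contDiffOn.continuousOn
  have hsource : EqOn (fun t => (0 : ℝ → ℝ) t - μ t * F t) (fun t => -(μ t * k t)) (Icc 0 1) :=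
    fun t ht => by simp [hkF ht]
  rw [radialInt_congr hsource hr, ← hF.init]
  refine eq_add_radialInt_of_contDiffOn hF.contDiffOn (by fun_prop) (fun t ht => ?_)
    (2 * n).succ_ne_zero hr
  have hode := hF.ode t (Ioo_subset_Ioc_self ht)
  rw [hmu (Ioo_subset_Ioc_self ht), ← hkF (Ioo_subset_Icc_self ht)] at hode
  push_cast
  linear_combination hode

theorem IsRegularSolution.eqOn (hμ : Continuous μ) (hmu : EqOn (mu f₀ Ω) μ (Ioc 0 1))
    (hF : IsRegularSolution f₀ n Ω F) (hF' : IsRegularSolution f₀ n Ω F') :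
    EqOn F F' (Icc 0 1) :=
  eqOn_of_eq_add_radialInt continuous_zero hμ hF.contDiffOn.continuousOn hF'.contDiffOn.continuousOn
    (fun _ => hF.eq_add_radialInt hμ hmu) (fun _ => hF'.eq_add_radialInt hμ hmu)

end RegularSolution

theorem lemma4p6_general {f₀ g : ℝ → ℝ} (hg : ContDiffOn ℝ 1 g (Icc 0 1))
    (hfg : ∀ r ∈ Icc (0 : ℝ) 1, f₀ r = g (r ^ 2)) (n : ℕ) {Ω : ℝ}
    (hΩ : Ω ∉ Icc (kappa₁ f₀) (kappa₂ f₀)) :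
    (IsRegularSolution f₀ n Ω (generator f₀ n Ω) ∧
      ∀ F, IsRegularSolution f₀ n Ω F → EqOn F (generator f₀ n Ω) (Icc 0 1)) ∧
    (1 ≤ n → Ω ≠ omegaHat f₀ n →
      ((∃ h, ContinuousOn h (Icc 0 1) ∧ (∃ r ∈ Icc (0 : ℝ) 1, h r ≠ 0) ∧
        SolvesKernelEq f₀ Ω n h) ↔ zeta f₀ n Ω = 0)) := by
  obtain ⟨μ, hμ, hmu⟩ := exists_continuous_eqOn_mu hg hfg hΩ
  obtain ⟨χ, F, hF, hF₀⟩ := exists_isRadialSolution (2 * n + 1) continuous_zero hμ 1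
  have hFreg := hF.isRegularSolution hmu hF₀
  have hgen : IsRegularSolution f₀ n Ω (generator f₀ n Ω) := Classical.epsilon_spec ⟨F, hFreg⟩
  refine ⟨⟨hgen, fun _ hF' => hF'.eqOn hμ hmu hgen⟩, fun hn hne => ?_⟩
  have hn₀ : n ≠ 0 := Nat.one_le_iff_ne_zero.1 hn
  have hG : Gfun f₀ Ω n 1 ≠ 0 := by
    rw [Gfun_one f₀ Ω hn₀]
    exact mul_ne_zero (Nat.cast_ne_zero.2 hn₀) (sub_ne_zero.2 hne)
  rw [exists_solvesKernelEq_iff (continuousOn_of_eq_comp_sq hg.continuousOn hfg) hμ hmu hn₀ hG hF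
    (hF₀ ▸ one_ne_zero), dispersion_congr (fun _ _ => rfl) (hFreg.eqOn hμ hmu hgen)]
  rfl

end

theorem lemma4p6 (f₀ : ℝ → ℝ) (hf₀ : IsProfile f₀) :
    (∀ n : ℕ, 1 ≤ n → ∀ Ω : ℝ, Ω ∉ Set.Icc (kappa₁ f₀) (kappa₂ f₀) →
      IsRegularSolution f₀ n Ω (generator f₀ n Ω) ∧
      ∀ F : ℝ → ℝ, IsRegularSolution f₀ n Ω F →
        Set.EqOn F (generator f₀ n Ω) (Set.Icc 0 1)) ∧
    ∃ C₀ : ℝ, 0 < C₀ ∧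
      ∀ n : ℕ, 1 ≤ n → ∀ Ω : ℝ, Ω ∉ Set.Icc (kappa₁ f₀) (kappa₂ f₀) →
        Ω ≠ omegaHat f₀ n →
        (kappa₂ f₀ < Ω → ∃ θ : ℝ, 0 < θ ∧ θ ≤ 1 ∧
          C₀ / (n * θ * (Ω - kappa₂ f₀) ^ θ) < 1) →
        ((∃ h : ℝ → ℝ, ContinuousOn h (Set.Icc 0 1) ∧ (∃ r ∈ Set.Icc (0 : ℝ) 1, h r ≠ 0) ∧
            SolvesKernelEq f₀ Ω n h) ↔
          zeta f₀ n Ω = 0) := by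
  obtain ⟨g, -, -, -, -, hg, -, hfg⟩ := hf₀.regular
  have hgeneral (n : ℕ) {Ω : ℝ} (hΩ : Ω ∉ Icc (kappa₁ f₀) (kappa₂ f₀)) :=
    lemma4p6_general (hg.of_le one_le_two) hfg n hΩ
  exact ⟨fun n _ Ω hΩ => (hgeneral n hΩ).1, 1, one_pos,
    fun n hn Ω hΩ hne _ => (hgeneral n hΩ).2 hn hne⟩
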